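/- Let $\textsf{E-PA}^{\omega}$ be classical Peano arithmetic in all finite types with the axiom of extensionality: the types are $0$ and, with $\rho,\tau$, also $\rho\to\tau$; the terms are built by application from typed variables and the constants $0$, $S$, the combinators $\Pi_{\rho,\tau}$, $\Sigma_{\delta,\rho,\tau}$ and the recursors $R_{\rho}$ of all finite types (Gödel's $T$); the only primitive predicate is $=_{0}$, and $x=_{\rho}y$ for $\rho=(\rho_1\to\dots\to\rho_k\to 0)$ abbreviates $(\forall z_1^{\rho_1}\dots z_k^{\rho_k})(xz_1\dots z_k=_0yz_1\dots z_k)$; the axioms are those of classical many-sorted logic, the equality axioms for $=_0$, the successor axioms, induction for all formulas, the defining equations of the combinators and recursors, and extensionality $x=_\rho y\rightarrow z(x)=_\tau z(y)$ in all types. Write $1=(0\to0)$, $2=(1\to 0)$, $3=(2\to0)$ and $f\leq_1 1$ for $(\forall n^0)(f(n)\leq 1)$. Let $\overline{f}n$ be the code (a number) of the finite sequence $\langle f(0),\dots,f(n-1)\rangle$, and for $T^1$ let $\sigma\in T$ mean $T(\sigma)=_0 1$. For $\Omega^3$, the formula $\textsf{MUC}(\Omega)$ (``$\Omega$ is an intuitionistic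 fan functional'') is $$(\forall Y^2)(\forall f,g\leq_1 1)\big(\overline{f}\,\Omega(Y)=\overline{g}\,\Omega(Y)\rightarrow Y(f)=Y(g)\big).$$ For $\Theta^{2\to(0\times 1^*)}$, which sends $g^2$ to a number $\Theta(g)(1)$ and a finite sequence $\Theta(g)(2)$ of objects of type $1$, the formula $\textsf{SCF}(\Theta)$ (``$\Theta$ is a special fan functional'') is $$(\forall g^2,\,T^1\leq_1 1)\Big[(\forall\alpha\in\Theta(g)(2))\big(\overline{\alpha}g(\alpha)\notin T\big)\rightarrow(\forall\beta\leq_1 1)(\exists i\leq\Theta(g)(1))\big(\overline{\beta}i\notin T\big)\Big].$$ Here $T$ ranges over all $T^1\le_1 1$, in particular over the characteristic functions of binary trees. An object of type $0\times 1^*$ is represented as a tuple: a number, and a finite sequence given by its length (type $0$) and the map $0\to1$ from indices to entries, of which only the entries below the length are used; a term of type $3\to(2\to(0\times1^*))$ is accordingly a tuple of three closed terms of $\textsf{E-PA}^{\omega}$, of types $3\to2\to0$, $3\to2\to0$ and $3\to2\to0\to1$. **Theorem.** There is a closed term $t$ of type $3\to(2\to(0\times1^*))$ such that $\textsf{E-PA}^{\omega}$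 proves $$(\forall\Omega^3)\big(\textsf{MUC}(\Omega)\rightarrow\textsf{SCF}(t(\Omega))\big).$$ -/

import Mathlib

/-! Peano arithmetic in all finite types with the axiom of extensionality, `E-PA^ω`, as a
formal system: finite types, Goedel's primitive recursive terms over the combinators and the
recursors, formulas of many-sorted logic, and a classical natural deduction calculus.  Terms and
formulas are intrinsically typed, and variables are de Bruijn indices into a list of types. -/

namespace EPAomega

/-- The finite types: `0`, and with `ρ`, `τ` also `ρ → τ`. -/
inductive Ty : Type
  | nat : Ty
  | arr : Ty → Ty → Ty

infixr:60 " ⇒ " => Ty.arr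

/-- The type `1 = 0 → 0` of number sequences. -/
abbrev Ty.one : Ty := Ty.nat ⇒ Ty.nat

/-- The type `2 = 1 → 0`. -/
abbrev Ty.two : Ty := Ty.one ⇒ Ty.nat

/-- The type `3 = 2 → 0`. -/
abbrev Ty.three : Ty := Ty.two ⇒ Ty.nat

/-- A context: the types of the free variables that are available. -/
abbrev Ctx : Type := List Ty

/-- `Var Γ τ`: the variables of type `τ` in the context `Γ`. -/
inductive Var : Ctx → Ty → Type
  | zero {Γ : Ctx} {τ : Ty} : Var (τ :: Γ) τ
  | succ {Γ : Ctx} {ρ τ : Ty} : Var Γ τ → Var (ρ :: Γ) τ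

/-- The constants: zero, successor, the combinators `Π` (here `K`) and `Σ` (here `S`), and
the recursor of each type. -/
inductive Con : Ty → Type
  | zero : Con Ty.nat
  | succ : Con (Ty.nat ⇒ Ty.nat)
  | K (ρ τ : Ty) : Con (ρ ⇒ τ ⇒ ρ)
  | S (δ ρ τ : Ty) : Con ((δ ⇒ ρ ⇒ τ) ⇒ (δ ⇒ ρ) ⇒ δ ⇒ τ)
  | R (ρ : Ty) : Con (Ty.nat ⇒ ρ ⇒ (ρ ⇒ Ty.nat ⇒ ρ) ⇒ ρ)

/-- Terms: variables, constants and application.  `Tm [] τ` is the type of closed terms. -/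
inductive Tm (Γ : Ctx) : Ty → Type
  | var {τ : Ty} : Var Γ τ → Tm Γ τ
  | con {τ : Ty} : Con τ → Tm Γ τ
  | app {ρ τ : Ty} : Tm Γ (ρ ⇒ τ) → Tm Γ ρ → Tm Γ τ

infixl:100 " ⬝ " => Tm.app

/-- Formulas.  The only prime formulas are `⊥` and equations of type `0`.  The logic is
classical, so `→`, `⊥` and `∀` suffice and the other connectives are abbreviations. -/
inductive Fm : Ctx → Type
  | bot {Γ : Ctx} : Fm Γ
  | eq {Γ : Ctx} : Tm Γ Ty.nat → Tm Γ Ty.nat → Fm Γ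
  | imp {Γ : Ctx} : Fm Γ → Fm Γ → Fm Γ
  | all {Γ : Ctx} (ρ : Ty) : Fm (ρ :: Γ) → Fm Γ

infixr:55 " ⟹ " => Fm.imp

/-! Substitution. -/

/-- A simultaneous substitution of terms over `Δ` for the variables in `Γ`. -/
abbrev Sub (Γ Δ : Ctx) : Type := ∀ ⦃τ : Ty⦄, Var Γ τ → Tm Δ τ

def Tm.subst {Γ Δ : Ctx} (s : Sub Γ Δ) : {τ : Ty} → Tm Γ τ → Tm Δ τ
  | _, .var x => s x
  | _, .con c => .con c
  | _, .app f a => .app (f.subst s) (a.subst s)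

/-- Weakening of a term by one additional variable. -/
def Tm.wk {Γ : Ctx} {ρ τ : Ty} (t : Tm Γ τ) : Tm (ρ :: Γ) τ :=
  t.subst fun _ x => .var x.succ

/-- The substitution that is used below a quantifier. -/
def Sub.lift {Γ Δ : Ctx} (s : Sub Γ Δ) (ρ : Ty) : Sub (ρ :: Γ) (ρ :: Δ)
  | _, .zero => .var .zero
  | _, .succ x => (s x).wk

/-- `t` for the last variable; all others stay. -/
def Sub.single {Γ : Ctx} {ρ : Ty} (t : Tm Γ ρ) : Sub (ρ :: Γ) Γ
  | _, .zero => t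
  | _, .succ x => .var x

def Fm.subst : {Γ Δ : Ctx} → Sub Γ Δ → Fm Γ → Fm Δ
  | _, _, _, .bot => .bot
  | _, _, s, .eq a b => .eq (a.subst s) (b.subst s)
  | _, _, s, .imp φ ψ => .imp (φ.subst s) (ψ.subst s)
  | _, _, s, .all ρ φ => .all ρ (φ.subst (s.lift ρ))

/-- Weakening of a formula by one additional variable. -/
def Fm.wk {Γ : Ctx} {ρ : Ty} (φ : Fm Γ) : Fm (ρ :: Γ) :=
  φ.subst fun _ x => .var x.succ

/-- `φ.inst t` is `φ(t)`, where `t` replaces the last variable. -/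
def Fm.inst {Γ : Ctx} {ρ : Ty} (φ : Fm (ρ :: Γ)) (t : Tm Γ ρ) : Fm Γ :=
  φ.subst (Sub.single t)

/-! Abbreviations. -/

def Tm.zero {Γ : Ctx} : Tm Γ Ty.nat := .con .zero

def Tm.succ {Γ : Ctx} (n : Tm Γ Ty.nat) : Tm Γ Ty.nat := .con .succ ⬝ n

def Tm.one {Γ : Ctx} : Tm Γ Ty.nat := Tm.zero.succ

/-- The last four variables of a context. -/
def v0 {Γ : Ctx} {a : Ty} : Tm (a :: Γ) a := .var .zero

def v1 {Γ : Ctx} {a b : Ty} : Tm (b :: a :: Γ) a := .var (.succ .zero)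

def v2 {Γ : Ctx} {a b c : Ty} : Tm (c :: b :: a :: Γ) a := .var (.succ (.succ .zero))

def v3 {Γ : Ctx} {a b c d : Ty} : Tm (d :: c :: b :: a :: Γ) a :=
  .var (.succ (.succ (.succ .zero)))

/-- The induction step substitution: the successor of the last variable for that variable. -/
def Sub.step {Γ : Ctx} : Sub (Ty.nat :: Γ) (Ty.nat :: Γ)
  | _, .zero => v0.succ
  | _, .succ x => .var x.succ

def Fm.neg {Γ : Ctx} (φ : Fm Γ) : Fm Γ := φ ⟹ .bot

def Fm.conj {Γ : Ctx} (φ ψ : Fm Γ) : Fm Γ := (φ ⟹ ψ.neg).neg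

def Fm.ex {Γ : Ctx} (ρ : Ty) (φ : Fm (ρ :: Γ)) : Fm Γ := (Fm.all ρ φ.neg).neg

/-- Equality of type `ρ₁ → ⋯ → ρₖ → 0` is the formula
`∀ z₁ ⋯ zₖ, s z₁ ⋯ zₖ = t z₁ ⋯ zₖ`. -/
def Fm.eqAt : (ρ : Ty) → {Γ : Ctx} → Tm Γ ρ → Tm Γ ρ → Fm Γ
  | .nat, _, s, t => .eq s t
  | .arr ρ τ, _, s, t => .all ρ (Fm.eqAt τ (s.wk ⬝ v0) (t.wk ⬝ v0))

/-! The formal system. -/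

/-- The non-logical axioms of `E-PA^ω`. -/
inductive Ax : {Γ : Ctx} → Fm Γ → Prop
  | refl {Γ : Ctx} (a : Tm Γ Ty.nat) : Ax (.eq a a)
  | symm {Γ : Ctx} (a b : Tm Γ Ty.nat) : Ax (.eq a b ⟹ .eq b a)
  | trans {Γ : Ctx} (a b c : Tm Γ Ty.nat) : Ax (.eq a b ⟹ .eq b c ⟹ .eq a c)
  /- successor -/
  | succ_ne_zero {Γ : Ctx} (a : Tm Γ Ty.nat) : Ax (Fm.eq a.succ .zero).neg
  | succ_inj {Γ : Ctx} (a b : Tm Γ Ty.nat) : Ax (.eq a.succ b.succ ⟹ .eq a b)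
  /- induction for arbitrary formulas: `φ(0) → ∀ n (φ(n) → φ(n+1)) → ∀ n φ(n)` -/
  | ind {Γ : Ctx} (φ : Fm (Ty.nat :: Γ)) :
      Ax (φ.inst .zero ⟹ .all Ty.nat (φ ⟹ φ.subst Sub.step) ⟹ .all Ty.nat φ)
  /- combinators: `Π x y = x` and `Σ x y z = x z (y z)` -/
  | K {Γ : Ctx} {ρ τ : Ty} (x : Tm Γ ρ) (y : Tm Γ τ) :
      Ax (.eqAt ρ (.con (.K ρ τ) ⬝ x ⬝ y) x)
  | S {Γ : Ctx} {δ ρ τ : Ty} (x : Tm Γ (δ ⇒ ρ ⇒ τ)) (y : Tm Γ (δ ⇒ ρ)) (z : Tm Γ δ) :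
      Ax (.eqAt τ (.con (.S δ ρ τ) ⬝ x ⬝ y ⬝ z) (x ⬝ z ⬝ (y ⬝ z)))
  /- recursors: `R 0 y z = y` and `R (n+1) y z = z (R n y z) n` -/
  | R_zero {Γ : Ctx} {ρ : Ty} (y : Tm Γ ρ) (z : Tm Γ (ρ ⇒ Ty.nat ⇒ ρ)) :
      Ax (.eqAt ρ (.con (.R ρ) ⬝ .zero ⬝ y ⬝ z) y)
  | R_succ {Γ : Ctx} {ρ : Ty} (n : Tm Γ Ty.nat) (y : Tm Γ ρ) (z : Tm Γ (ρ ⇒ Ty.nat ⇒ ρ)) :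
      Ax (.eqAt ρ (.con (.R ρ) ⬝ n.succ ⬝ y ⬝ z) (z ⬝ (.con (.R ρ) ⬝ n ⬝ y ⬝ z) ⬝ n))
  /- extensionality: `x = y → z x = z y` in all types -/
  | ext {Γ : Ctx} {ρ τ : Ty} (z : Tm Γ (ρ ⇒ τ)) (x y : Tm Γ ρ) :
      Ax (.eqAt ρ x y ⟹ .eqAt τ (z ⬝ x) (z ⬝ y))

/-- `Proves H φ`: the formula `φ` is derivable in `E-PA^ω` from the hypotheses `H`, by classical
natural deduction. -/
inductive Proves : {Γ : Ctx} → List (Fm Γ) → Fm Γ → Prop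
  | ax {Γ : Ctx} {H : List (Fm Γ)} {φ : Fm Γ} : Ax φ → Proves H φ
  | hyp {Γ : Ctx} {H : List (Fm Γ)} {φ : Fm Γ} : φ ∈ H → Proves H φ
  | imp_intro {Γ : Ctx} {H : List (Fm Γ)} {φ ψ : Fm Γ} :
      Proves (φ :: H) ψ → Proves H (φ ⟹ ψ)
  | imp_elim {Γ : Ctx} {H : List (Fm Γ)} {φ ψ : Fm Γ} :
      Proves H (φ ⟹ ψ) → Proves H φ → Proves H ψ
  | by_contra {Γ : Ctx} {H : List (Fm Γ)} {φ : Fm Γ} :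
      Proves (φ.neg :: H) .bot → Proves H φ
  | all_intro {Γ : Ctx} {H : List (Fm Γ)} {ρ : Ty} {φ : Fm (ρ :: Γ)} :
      Proves (H.map Fm.wk) φ → Proves H (.all ρ φ)
  | all_elim {Γ : Ctx} {H : List (Fm Γ)} {ρ : Ty} {φ : Fm (ρ :: Γ)} (t : Tm Γ ρ) :
      Proves H (.all ρ φ) → Proves H (φ.inst t)

/-- `E-PA^ω` proves the sentence `φ`. -/
def EPA (φ : Fm []) : Prop := Proves [] φ

/-! Some primitive recursive terms. -/

/-- Lambda abstraction, by means of the combinators: `(lam t) x = t` is provable. -/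
def Tm.lam {Γ : Ctx} {ρ : Ty} : {τ : Ty} → Tm (ρ :: Γ) τ → Tm Γ (ρ ⇒ τ)
  | _, .var .zero => .con (.S ρ (ρ ⇒ ρ) ρ) ⬝ .con (.K ρ (ρ ⇒ ρ)) ⬝ .con (.K ρ ρ)
  | _, .var (.succ x) => .con (.K _ ρ) ⬝ .var x
  | _, .con c => .con (.K _ ρ) ⬝ .con c
  | _, .app f a => .con (.S ρ _ _) ⬝ f.lam ⬝ a.lam

/-- `natRec n y t` is defined by primitive recursion on `n`, with the value `y` at `0` and the
value `t(p, n)` at `n + 1`, where `p` (the variable `v1` of `t`) is the value at `n` (and `n` is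
the variable `v0` of `t`). -/
def Tm.natRec {Γ : Ctx} {ρ : Ty} (n : Tm Γ Ty.nat) (y : Tm Γ ρ)
    (t : Tm (Ty.nat :: ρ :: Γ) ρ) : Tm Γ ρ :=
  .con (.R ρ) ⬝ n ⬝ y ⬝ t.lam.lam

/-- The predecessor, with `0` as the predecessor of `0`. -/
def Tm.pred {Γ : Ctx} (n : Tm Γ Ty.nat) : Tm Γ Ty.nat := n.natRec .zero v0

/-- Truncated subtraction `m ∸ n`. -/
def Tm.monus {Γ : Ctx} (m n : Tm Γ Ty.nat) : Tm Γ Ty.nat := n.natRec m (Tm.pred v1)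

/-- `2 n`. -/
def Tm.double {Γ : Ctx} (n : Tm Γ Ty.nat) : Tm Γ Ty.nat := n.natRec .zero v1.succ.succ

/-- Appending the number `a` to the finite sequence with code `s`.  The code of `s * ⟨a⟩` is
`2 ^ a * (2 s + 1)`, and the code of the empty sequence is `0`, so that every number is the code of
exactly one finite sequence of numbers. -/
def Tm.snoc {Γ : Ctx} (s a : Tm Γ Ty.nat) : Tm Γ Ty.nat :=
  a.natRec s.double.succ (Tm.double v1)

/-- The initial segment `⟨f(0), …, f(n-1)⟩` of `f`, as a code. -/
def Tm.bar {Γ : Ctx} (f : Tm Γ Ty.one) (n : Tm Γ Ty.nat) : Tm Γ Ty.nat :=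
  n.natRec .zero (Tm.snoc v1 (f.wk.wk ⬝ v0))

/-- `m ≤ n`. -/
def Fm.le {Γ : Ctx} (m n : Tm Γ Ty.nat) : Fm Γ := .eq (m.monus n) .zero

/-- `m < n`. -/
def Fm.lt {Γ : Ctx} (m n : Tm Γ Ty.nat) : Fm Γ := Fm.le m.succ n

/-- `f ≤₁ 1`, that is `f(n) ≤ 1` for all `n`. -/
def Fm.binary {Γ : Ctx} (f : Tm Γ Ty.one) : Fm Γ := .all Ty.nat (Fm.le (f.wk ⬝ v0) .one)

/-- `s ∈ T`, where `T` is given by its characteristic function: `T(s) = 1`. -/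
def Fm.mem {Γ : Ctx} (s : Tm Γ Ty.nat) (T : Tm Γ Ty.one) : Fm Γ := .eq (T ⬝ s) .one

/-! The two kinds of fan functionals. -/

/-- `MUC(Ω)`, for `Ω` of type `3`:
`∀ Y² ∀ f, g ≤₁ 1 (bar f (Ω Y) = bar g (Ω Y) → Y f = Y g)`. -/
def MUC {Γ : Ctx} (Om : Tm Γ Ty.three) : Fm Γ :=
  .all Ty.two <| .all Ty.one <| .all Ty.one <|
    -- `Y`, `f`, `g` are the variables `v2`, `v1`, `v0`
    Fm.binary v1 ⟹ Fm.binary v0 ⟹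
    .eq (Tm.bar v1 (Om.wk.wk.wk ⬝ v2)) (Tm.bar v0 (Om.wk.wk.wk ⬝ v2)) ⟹
    .eq (v2 ⬝ v1) (v2 ⬝ v0)

/-- A functional of type `2 → (0 × 1*)`.  Products are tuples, and a finite sequence of objects of
type `1` is a length together with a map that sends each index to its entry (only the entries below
the length matter).  So a functional of this type consists of three components: the number
`Θ(g)(1)`, and the length and the entries of the finite sequence `Θ(g)(2)`. -/
structure FanTm (Γ : Ctx) : Type where
  /-- `Θ(g)(1)` is `num ⬝ g`. -/
  num : Tm Γ (Ty.two ⇒ Ty.nat)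
  /-- The length of `Θ(g)(2)` is `len ⬝ g`. -/
  len : Tm Γ (Ty.two ⇒ Ty.nat)
  /-- The entry with index `i` of `Θ(g)(2)` is `entry ⬝ g ⬝ i`. -/
  entry : Tm Γ (Ty.two ⇒ Ty.nat ⇒ Ty.one)

def FanTm.wk {Γ : Ctx} {ρ : Ty} (Th : FanTm Γ) : FanTm (ρ :: Γ) :=
  ⟨Th.num.wk, Th.len.wk, Th.entry.wk⟩

/-- `SCF(Θ)`: `∀ g² ∀ T ≤₁ 1`, if `bar α (g α) ∉ T` for all entries `α` of the finite sequence
`Θ(g)(2)`, then `∀ β ≤₁ 1 ∃ i ≤ Θ(g)(1), bar β i ∉ T`. -/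
def SCF {Γ : Ctx} (Th : FanTm Γ) : Fm Γ :=
  .all Ty.two <| .all Ty.one <|
    -- `g`, `T` are the variables `v1`, `v0`
    Fm.binary v0 ⟹
    (.all Ty.nat <|
      -- `g`, `T`, `j` are the variables `v2`, `v1`, `v0`
      Fm.lt v0 (Th.wk.wk.wk.len ⬝ v2) ⟹
      (Fm.mem (Tm.bar (Th.wk.wk.wk.entry ⬝ v2 ⬝ v0) (v2 ⬝ (Th.wk.wk.wk.entry ⬝ v2 ⬝ v0)))
        v1).neg) ⟹
    (.all Ty.one <|
      -- `g`, `T`, `β` are the variables `v2`, `v1`, `v0`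
      Fm.binary v0 ⟹
      (Fm.ex Ty.nat <|
        -- `g`, `T`, `β`, `i` are the variables `v3`, `v2`, `v1`, `v0`
        (Fm.le v0 (Th.wk.wk.wk.wk.num ⬝ v3)).conj (Fm.mem (Tm.bar v1 v0) v2).neg))

/-- A closed term of type `3 → (2 → (0 × 1*))`, as a tuple of closed terms of `E-PA^ω`. -/
structure FanTransformer : Type where
  num : Tm [] (Ty.three ⇒ Ty.two ⇒ Ty.nat)
  len : Tm [] (Ty.three ⇒ Ty.two ⇒ Ty.nat)
  entry : Tm [] (Ty.three ⇒ Ty.two ⇒ Ty.nat ⇒ Ty.one)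

/-- `t(Ω)`, where `Ω` is a variable of type `3`. -/
def FanTransformer.apply (t : FanTransformer) : FanTm [Ty.three] :=
  ⟨t.num.wk ⬝ v0, t.len.wk ⬝ v0, t.entry.wk ⬝ v0⟩

end EPAomega

/-! For binary f, the functional Y(f) = 2 g(f) + f(g(f)) codes m = g(f) together with the bit of f
at m. Put n = Ω(Y). A binary f and the sequence that equals f below n and is flipped from n on have
the same value under Y, hence the same m and the same bit at m; so m < n. One call of Ω therefore
bounds g strictly on Cantor space (`app_lt_bound`).

For the list, the entry with index j is the sequence of binary digits of j. The list must reach the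
number with digits β(0), …, β(n-1) for every binary β; a sufficient length is found without
exponentiation, by applying the same bound to the functional that sends β to this number. The entry
α at that index agrees with β below n (`Q.cond_digit_code`), and g(α) < n, so α and β have the same
initial segment of length g(α). Hence i = g(α) is the required witness.

The derivation is built in the model `Q H` of terms modulo equality provable from `H`, where
object-level equations become equations of Lean. Extensionality (`ev_ext`) and induction
(`ev_induction`) ask for equations that hold for all contexts and all hypothesis lists; this
uniformity stands for reasoning about a fresh variable. As both apply to equations only, side
conditions such as k < n are built into terms as guards, by means of `cond`, whose first branch is
taken at 0. -/

namespace EPAomega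

section

variable {Γ Δ Θ Γ₀ : Ctx} {ρ σ τ : Ty}

/-! Substitution. -/

theorem Tm.subst_subst (s : Sub Γ Δ) (r : Sub Δ Θ) (t : Tm Γ τ) :
    (t.subst s).subst r = t.subst fun _ x => (s x).subst r := by
  induction t with
  | var x => rfl
  | con c => rfl
  | app f a hf ha => exact congrArg₂ Tm.app hf ha

theorem Tm.subst_id (t : Tm Γ τ) : t.subst (fun _ x => .var x) = t := by
  induction t with
  | var x => rfl
  | con c => rfl
  | app f a hf ha => exact congrArg₂ Tm.app hf ha

/-- The simultaneous substitution `s`, extended by `t` for the last variable. -/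
def Sub.cons (t : Tm Δ ρ) (s : Sub Γ Δ) : Sub (ρ :: Γ) Δ
  | _, .zero => t
  | _, .succ x => s x

theorem Tm.wk_subst_lift (s : Sub Γ Δ) (t : Tm Γ τ) :
    (t.wk (ρ := ρ)).subst (s.lift ρ) = (t.subst s).wk := by
  rw [Tm.wk, Tm.wk, Tm.subst_subst, Tm.subst_subst]; rfl

theorem Tm.wk_subst_single (u : Tm Γ ρ) (t : Tm Γ τ) : t.wk.subst (Sub.single u) = t := by
  rw [Tm.wk, Tm.subst_subst]; exact t.subst_id

theorem Tm.wk_subst_step (t : Tm Γ τ) : t.wk.subst Sub.step = t.wk := by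
  rw [Tm.wk, Tm.subst_subst]; rfl

theorem Sub.lift_comp (s : Sub Γ Δ) (r : Sub Δ Θ) :
    (fun _ x => (s.lift ρ x).subst (r.lift ρ) : Sub (ρ :: Γ) (ρ :: Θ)) =
      Sub.lift (fun _ x => (s x).subst r) ρ := by
  funext τ x
  cases x with
  | zero => rfl
  | succ x => exact Tm.wk_subst_lift r (s x)

theorem Fm.subst_subst (s : Sub Γ Δ) (r : Sub Δ Θ) (φ : Fm Γ) :
    (φ.subst s).subst r = φ.subst fun _ x => (s x).subst r := by
  induction φ generalizing Δ Θ with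
  | bot => rfl
  | eq a b => exact congrArg₂ Fm.eq (Tm.subst_subst s r a) (Tm.subst_subst s r b)
  | imp φ ψ hφ hψ => exact congrArg₂ Fm.imp (hφ s r) (hψ s r)
  | all ρ φ hφ =>
    exact congrArg (Fm.all ρ) ((hφ _ _).trans (congrArg (fun s => φ.subst s) (Sub.lift_comp s r)))

theorem Fm.subst_lift_inst (s : Sub Γ Δ) (u : Tm Δ ρ) (φ : Fm (ρ :: Γ)) :
    (φ.subst (s.lift ρ)).inst u = φ.subst (Sub.cons u s) := by
  rw [Fm.inst, Fm.subst_subst]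
  congr 1
  funext τ x
  cases x with
  | zero => rfl
  | succ x => exact Tm.wk_subst_single u (s x)

theorem Fm.eqAt_subst (s : Sub Γ Δ) (a b : Tm Γ τ) :
    (Fm.eqAt τ a b).subst s = Fm.eqAt τ (a.subst s) (b.subst s) := by
  induction τ generalizing Γ Δ with
  | nat => rfl
  | arr ρ τ _ ih =>
    simp only [Fm.eqAt, Fm.subst, ih, Tm.subst, Tm.wk_subst_lift]
    rfl

theorem Fm.eqAt_wk (a b : Tm Γ τ) : (Fm.eqAt τ a b).wk (ρ := ρ) = Fm.eqAt τ a.wk b.wk :=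
  Fm.eqAt_subst _ a b

/-! Derived rules. -/

theorem Proves.weaken {H H' : List (Fm Γ)} {φ : Fm Γ} (h : Proves H φ) (hH : H ⊆ H') :
    Proves H' φ := by
  induction h with
  | ax h => exact .ax h
  | hyp h => exact .hyp (hH h)
  | imp_intro _ ih => exact .imp_intro (ih (List.cons_subset_cons _ hH))
  | imp_elim _ _ ih₁ ih₂ => exact .imp_elim (ih₁ hH) (ih₂ hH)
  | by_contra _ ih => exact .by_contra (ih (List.cons_subset_cons _ hH))
  | all_intro _ ih => exact .all_intro (ih (List.map_subset _ hH))
  | all_elim t _ ih => exact .all_elim t (ih hH)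

theorem Proves.cut {H : List (Fm Γ)} {φ ψ : Fm Γ} (h : Proves (φ :: H) ψ) (hφ : Proves H φ) :
    Proves H ψ :=
  .imp_elim (.imp_intro h) hφ

theorem Proves.all_subst_elim {H : List (Fm Δ)} {s : Sub Γ Δ} {φ : Fm (ρ :: Γ)}
    (h : Proves H ((Fm.all ρ φ).subst s)) (u : Tm Δ ρ) : Proves H (φ.subst (Sub.cons u s)) :=
  Fm.subst_lift_inst s u φ ▸ Proves.all_elim u h

theorem Proves.eqAt_app {H : List (Fm Γ)} {f g : Tm Γ (ρ ⇒ τ)} (h : Proves H (.eqAt _ f g))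
    (a : Tm Γ ρ) : Proves H (.eqAt τ (f ⬝ a) (g ⬝ a)) := by
  have h' := Proves.all_elim a h
  rw [Fm.inst, Fm.eqAt_subst] at h'
  simp only [Tm.subst, Tm.wk_subst_single] at h'
  exact h'

theorem Proves.eqAt_refl {H : List (Fm Γ)} (a : Tm Γ τ) : Proves H (.eqAt τ a a) := by
  induction τ generalizing Γ with
  | nat => exact .ax (.refl a)
  | arr ρ τ _ ih => exact .all_intro (ih _)

theorem Proves.eqAt_symm {H : List (Fm Γ)} {a b : Tm Γ τ} (h : Proves H (.eqAt τ a b)) :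
    Proves H (.eqAt τ b a) := by
  induction τ generalizing Γ with
  | nat => exact .imp_elim (.ax (.symm a b)) h
  | arr ρ τ _ ih =>
    -- The equation is discharged as a hypothesis first, so that `all_intro` weakens it to the
    -- context with the fresh variable; `cut` restores it afterwards.
    refine .cut (.all_intro (ih (Proves.eqAt_app ?_ v0))) h
    exact .hyp (by simp [Fm.eqAt_wk])

theorem Proves.eqAt_trans {H : List (Fm Γ)} {a b c : Tm Γ τ} (h₁ : Proves H (.eqAt τ a b))
    (h₂ : Proves H (.eqAt τ b c)) : Proves H (.eqAt τ a c) := by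
  induction τ generalizing Γ with
  | nat => exact .imp_elim (.imp_elim (.ax (.trans a b c)) h₁) h₂
  | arr ρ τ _ ih =>
    refine .cut (.cut (.all_intro (ih (Proves.eqAt_app (g := b.wk) ?_ v0)
      (Proves.eqAt_app ?_ v0))) (h₁.weaken (List.subset_cons_self _ _))) h₂
    · exact .hyp (by simp [Fm.eqAt_wk])
    · exact .hyp (by simp [Fm.eqAt_wk])

/-! The model of terms modulo provable equality. -/

/-- Terms up to provable equality from the hypotheses `H`. -/
def Q (H : List (Fm Γ)) (τ : Ty) : Type :=
  Quot fun a b : Tm Γ τ => Proves H (.eqAt τ a b)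

/-- The class of a term. -/
def q (H : List (Fm Γ)) (a : Tm Γ τ) : Q H τ := Quot.mk _ a

/-- Provable equality is already an equivalence relation, so the quotient identifies nothing more.
This is the passage between derivations and equations in the model. -/
theorem q_eq {H : List (Fm Γ)} {a b : Tm Γ τ} : q H a = q H b ↔ Proves H (.eqAt τ a b) := by
  have hE : Equivalence fun a b : Tm Γ τ => Proves H (.eqAt τ a b) :=
    ⟨Proves.eqAt_refl, Proves.eqAt_symm, Proves.eqAt_trans⟩
  exact ⟨fun h => hE.eqvGen_iff.1 (Quot.eqvGen_exact h), fun h => Quot.sound h⟩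

namespace Q

/-- Application. -/
def app {H : List (Fm Γ)} : Q H (ρ ⇒ τ) → Q H ρ → Q H τ :=
  -- Compatibility in the argument is exactly the axiom of extensionality.
  Quot.map₂ Tm.app (fun f a b h => .imp_elim (.ax (.ext f a b)) h)
    (fun _ _ a h => Proves.eqAt_app h a)

infixl:100 " ⬩ " => Q.app

variable {H : List (Fm Γ)}

theorem exists_rep (x : Q H τ) : ∃ a, q H a = x := Quot.exists_rep x

/-- Zero. -/
def zero : Q H Ty.nat := q H Tm.zero

/-- The successor. -/
def succ (x : Q H Ty.nat) : Q H Ty.nat := q H (.con .succ) ⬩ x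

/-- Primitive recursion. -/
def recN (n : Q H Ty.nat) (y : Q H ρ) (z : Q H (ρ ⇒ Ty.nat ⇒ ρ)) : Q H ρ :=
  q H (.con (.R ρ)) ⬩ n ⬩ y ⬩ z

@[simp] theorem K_app (x : Q H ρ) (y : Q H τ) : q H (.con (.K ρ τ)) ⬩ x ⬩ y = x := by
  obtain ⟨x, rfl⟩ := x.exists_rep
  obtain ⟨y, rfl⟩ := y.exists_rep
  exact q_eq.2 (.ax (.K x y))

@[simp] theorem S_app (x : Q H (σ ⇒ ρ ⇒ τ)) (y : Q H (σ ⇒ ρ)) (z : Q H σ) :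
    q H (.con (.S σ ρ τ)) ⬩ x ⬩ y ⬩ z = x ⬩ z ⬩ (y ⬩ z) := by
  obtain ⟨x, rfl⟩ := x.exists_rep
  obtain ⟨y, rfl⟩ := y.exists_rep
  obtain ⟨z, rfl⟩ := z.exists_rep
  exact q_eq.2 (.ax (.S x y z))

@[simp] theorem recN_zero (y : Q H ρ) (z : Q H (ρ ⇒ Ty.nat ⇒ ρ)) : recN zero y z = y := by
  obtain ⟨y, rfl⟩ := y.exists_rep
  obtain ⟨z, rfl⟩ := z.exists_rep
  exact q_eq.2 (.ax (.R_zero y z))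

@[simp] theorem recN_succ (n : Q H Ty.nat) (y : Q H ρ) (z : Q H (ρ ⇒ Ty.nat ⇒ ρ)) :
    recN n.succ y z = z ⬩ recN n y z ⬩ n := by
  obtain ⟨n, rfl⟩ := n.exists_rep
  obtain ⟨y, rfl⟩ := y.exists_rep
  obtain ⟨z, rfl⟩ := z.exists_rep
  exact q_eq.2 (.ax (.R_succ n y z))

end Q

/-! ### Evaluation of terms, extensionality and induction in the model. -/

/-- An assignment of elements of the term model to the variables in `Γ₀`. -/
abbrev Env (Γ₀ : Ctx) (H : List (Fm Γ)) : Type := ∀ ⦃τ : Ty⦄, Var Γ₀ τ → Q H τ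

section Env

variable {H : List (Fm Γ)}

/-- The assignment with no variables. -/
def Env.nil : Env [] H := fun _ x => nomatch x

/-- The assignment `e`, extended by `x` for the last variable. -/
def Env.cons (e : Env Γ₀ H) (x : Q H ρ) : Env (ρ :: Γ₀) H
  | _, .zero => x
  | _, .succ y => e y

/-- The value of a term. -/
def ev (e : Env Γ₀ H) : {τ : Ty} → Tm Γ₀ τ → Q H τ
  | _, .var x => e x
  | _, .con c => q H (.con c)
  | _, .app f a => ev e f ⬩ ev e a

@[simp] theorem ev_app (e : Env Γ₀ H) (f : Tm Γ₀ (ρ ⇒ τ)) (a : Tm Γ₀ ρ) :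
    ev e (f ⬝ a) = ev e f ⬩ ev e a := rfl

@[simp] theorem ev_con (e : Env Γ₀ H) (c : Con τ) : ev e (.con c) = q H (.con c) := rfl

@[simp] theorem ev_zero (e : Env Γ₀ H) : ev e Tm.zero = Q.zero := rfl

@[simp] theorem ev_succ (e : Env Γ₀ H) (a : Tm Γ₀ Ty.nat) : ev e a.succ = (ev e a).succ := rfl

@[simp] theorem ev_one (e : Env Γ₀ H) : ev e Tm.one = Q.zero.succ := rfl

@[simp] theorem ev_v0 (e : Env Γ₀ H) (x : Q H ρ) : ev (e.cons x) v0 = x := rfl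

@[simp] theorem ev_v1 (e : Env (ρ :: Γ₀) H) (y : Q H σ) :
    ev (e.cons y) v1 = ev e v0 := rfl

@[simp] theorem ev_v2 (e : Env (ρ :: σ :: Γ₀) H) (y : Q H τ) :
    ev (e.cons y) v2 = ev e v1 := rfl

@[simp] theorem ev_v3 {υ : Ty} (e : Env (ρ :: σ :: τ :: Γ₀) H) (y : Q H υ) :
    ev (e.cons y) v3 = ev e v2 := rfl

theorem ev_subst (e : Env Δ H) (s : Sub Γ₀ Δ) (t : Tm Γ₀ τ) :
    ev e (t.subst s) = ev (fun _ x => ev e (s x)) t := by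
  induction t with
  | var x => rfl
  | con c => rfl
  | app f a hf ha => exact congrArg₂ Q.app hf ha

theorem q_subst (s : Sub Γ₀ Γ) (t : Tm Γ₀ τ) : q H (t.subst s) = ev (fun _ x => q H (s x)) t := by
  induction t with
  | var x => rfl
  | con c => rfl
  | app f a hf ha => exact congrArg₂ Q.app hf ha

theorem q_eq_ev (t : Tm Γ τ) : q H t = ev (fun _ x => q H (.var x)) t := by
  rw [← q_subst, Tm.subst_id]

@[simp] theorem ev_wk (e : Env Γ₀ H) (x : Q H ρ) (t : Tm Γ₀ τ) : ev (e.cons x) t.wk = ev e t :=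
  ev_subst _ _ t

@[simp] theorem ev_lam (e : Env Γ₀ H) (t : Tm (ρ :: Γ₀) τ) (x : Q H ρ) :
    ev e t.lam ⬩ x = ev (e.cons x) t := by
  induction t with
  | var y =>
    cases y with
    | zero => exact (Q.S_app _ _ x).trans (Q.K_app x _)
    | succ y => exact Q.K_app _ x
  | con c => exact Q.K_app _ x
  | app f a hf ha => exact (Q.S_app _ _ x).trans (congrArg₂ Q.app hf ha)

/-- Choosing representatives turns an assignment into a substitution, so that a claim about values
becomes a claim about derivations. -/
theorem Env.exists_rep (e : Env Γ₀ H) : ∃ s : Sub Γ₀ Γ, e = fun _ x => q H (s x) :=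
  ⟨fun _ x => Quot.out (e x), by funext τ x; exact (Quot.out_eq (e x)).symm⟩

theorem Env.cons_q (s : Sub Γ₀ Γ) (t : Tm Γ ρ) :
    Env.cons (fun _ x => q H (s x)) (q H t) = fun _ x => q H (Sub.cons t s x) := by
  funext τ x
  cases x <;> rfl

/-- The natural assignment after weakening by a fresh variable. -/
theorem Env.cons_q_wk {H' : List (Fm (ρ :: Γ))} (s : Sub Γ₀ Γ) :
    Env.cons (fun _ x => q H' (s x).wk) (q H' v0) = fun _ x => q H' (s.lift ρ x) := by
  funext τ x
  cases x <;> rfl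

/-- Extensionality, where the functions may agree by virtue of an equation between parameters. -/
theorem ev_ext_of_eq (a b : Tm Γ₀ σ) (t u : Tm Γ₀ (ρ ⇒ τ))
    (h : ∀ {Γ : Ctx} {H : List (Fm Γ)} (e : Env Γ₀ H) (x : Q H ρ), ev e a = ev e b →
      ev e t ⬩ x = ev e u ⬩ x)
    (e : Env Γ₀ H) (hab : ev e a = ev e b) : ev e t = ev e u := by
  obtain ⟨s, rfl⟩ := e.exists_rep
  rw [← q_subst, ← q_subst, q_eq] at hab ⊢
  -- The equation between the parameters travels in the hypothesis list to the context with a fresh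
  -- variable, where `h` is applied to that variable.
  refine .cut (.all_intro (q_eq.1 ?_)) hab
  set H' : List (Fm (ρ :: Γ)) :=
    ((Fm.eqAt σ (a.subst s) (b.subst s)) :: H).map Fm.wk
  have hyp : q H' (a.subst s).wk = q H' (b.subst s).wk :=
    q_eq.2 (.hyp (by simp [H', Fm.eqAt_wk]))
  have hb : ∀ {υ : Ty} (t : Tm Γ₀ υ),
      q H' (t.subst s).wk = ev (fun _ x => q H' (s x).wk) t := by
    intro υ t
    rw [Tm.wk, Tm.subst_subst]
    exact q_subst _ _
  rw [hb, hb] at hyp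
  have key := h (H := H') _ (q H' v0) hyp
  rw [← hb, ← hb] at key
  exact key

theorem ev_ext (t u : Tm Γ₀ (ρ ⇒ τ))
    (h : ∀ {Γ : Ctx} {H : List (Fm Γ)} (e : Env Γ₀ H) (x : Q H ρ), ev e t ⬩ x = ev e u ⬩ x)
    (e : Env Γ₀ H) : ev e t = ev e u :=
  ev_ext_of_eq Tm.zero Tm.zero t u (fun e x _ => h e x) e rfl

/-- Extensionality for abstractions over different contexts. -/
theorem q_lam_congr {Γ₁ Γ₂ : Ctx} (s₁ : Sub Γ₁ Γ) (s₂ : Sub Γ₂ Γ) (t : Tm (ρ :: Γ₁) τ)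
    (u : Tm (ρ :: Γ₂) τ)
    (h : q (H.map (Fm.wk (ρ := ρ))) (t.subst (s₁.lift ρ)) = q (H.map Fm.wk) (u.subst (s₂.lift ρ))) :
    q H (t.lam.subst s₁) = q H (u.lam.subst s₂) := by
  refine q_eq.2 (.all_intro (q_eq.1 ?_))
  have hb : ∀ {Γ₁ : Ctx} (s : Sub Γ₁ Γ) (t : Tm (ρ :: Γ₁) τ),
      q (H.map Fm.wk) ((t.lam.subst s).wk ⬝ v0) = q (H.map Fm.wk) (t.subst (s.lift ρ)) := by
    intro Γ₁ s t
    rw [q_subst _ t, ← Env.cons_q_wk, ← ev_lam, Tm.wk, Tm.subst_subst]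
    exact congrArg (fun f => Q.app f (q (H.map Fm.wk) v0)) (q_subst _ _)
  rw [hb, hb, h]

/-- Induction for equations. -/
theorem ev_induction (t u : Tm (Ty.nat :: Γ₀) τ)
    (h₀ : ∀ {Γ : Ctx} {H : List (Fm Γ)} (e : Env Γ₀ H),
      ev (e.cons Q.zero) t = ev (e.cons Q.zero) u)
    (h₁ : ∀ {Γ : Ctx} {H : List (Fm Γ)} (e : Env Γ₀ H) (n : Q H Ty.nat),
      ev (e.cons n) t = ev (e.cons n) u → ev (e.cons n.succ) t = ev (e.cons n.succ) u)
    (e : Env Γ₀ H) (n : Q H Ty.nat) : ev (e.cons n) t = ev (e.cons n) u := by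
  obtain ⟨s, rfl⟩ := e.exists_rep
  obtain ⟨n, rfl⟩ := n.exists_rep
  have hφ : ∀ n : Tm Γ Ty.nat,
      Proves H ((Fm.eqAt τ (t.subst (s.lift _)) (u.subst (s.lift _))).inst n) ↔
      ev (Env.cons (fun _ x => q H (s x)) (q H n)) t =
        ev (Env.cons (fun _ x => q H (s x)) (q H n)) u := by
    intro n
    rw [← Fm.eqAt_subst, Fm.subst_lift_inst, Fm.eqAt_subst, ← q_eq, Env.cons_q, q_subst, q_subst]
  refine (hφ n).1 (.all_elim n (.imp_elim (.imp_elim (.ax (.ind _)) ((hφ _).2 (h₀ _))) ?_))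
  refine .all_intro (.imp_intro ?_)
  set H' := Fm.eqAt τ (t.subst (s.lift _)) (u.subst (s.lift _)) :: H.map Fm.wk
  have hyp : q H' (t.subst (s.lift _)) = q H' (u.subst (s.lift _)) :=
    q_eq.2 (.hyp (by simp [H']))
  have key := h₁ (H := H') (fun _ x => q H' (s x).wk) (q H' v0) (by
    rwa [Env.cons_q_wk, ← q_subst, ← q_subst])
  have hb : ∀ t : Tm (Ty.nat :: Γ₀) τ, q H' ((t.subst (s.lift _)).subst Sub.step) =
      ev (Env.cons (fun _ x => q H' (s x).wk) (q H' v0).succ) t := by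
    intro t
    rw [Tm.subst_subst, q_subst]
    congr 1
    funext τ x
    cases x with
    | zero => rfl
    | succ x => exact congrArg (q H') (Tm.wk_subst_step (s x))
  rw [Fm.eqAt_subst, ← q_eq, hb, hb, key]

/-- A closed term in an arbitrary context. -/
def Tm.emb (c : Tm [] τ) : Tm Γ τ := c.subst fun _ (x : Var [] _) => nomatch x

/-- The value of a closed term. -/
def Q.cl (c : Tm [] τ) : Q H τ := ev Env.nil c

@[simp] theorem Q.cl_lam (t : Tm [ρ] τ) (x : Q H ρ) :
    Q.cl t.lam ⬩ x = ev (Env.nil.cons x) t := ev_lam _ t x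

@[simp] theorem ev_emb (e : Env Γ₀ H) (c : Tm [] τ) : ev e c.emb = Q.cl c := by
  rw [Tm.emb, ev_subst, Q.cl]
  congr 1
  funext τ x
  cases x

theorem ev_closed (e : Env [] H) (c : Tm [] τ) : ev e c = Q.cl c := by
  rw [Q.cl]
  congr 1
  funext τ x
  cases x

/-- Primitive recursion with a given step function. -/
def Tm.recN (n : Tm Γ Ty.nat) (y : Tm Γ ρ) (z : Tm Γ (ρ ⇒ Ty.nat ⇒ ρ)) : Tm Γ ρ :=
  .con (.R ρ) ⬝ n ⬝ y ⬝ z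

@[simp] theorem ev_recN (e : Env Γ₀ H) (n : Tm Γ₀ Ty.nat) (y : Tm Γ₀ ρ)
    (z : Tm Γ₀ (ρ ⇒ Ty.nat ⇒ ρ)) :
    ev e (n.recN y z) = Q.recN (ev e n) (ev e y) (ev e z) := rfl

@[simp] theorem ev_natRec (e : Env Γ₀ H) (n : Tm Γ₀ Ty.nat) (y : Tm Γ₀ ρ)
    (t : Tm (Ty.nat :: ρ :: Γ₀) ρ) :
    ev e (n.natRec y t) = Q.recN (ev e n) (ev e y) (ev e t.lam.lam) := rfl

end Env

end

section

variable {Γ Γ₀ : Ctx} {H : List (Fm Γ)}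

/-! Arithmetic. -/

/-- The predecessor. -/
def Q.pred (x : Q H Ty.nat) : Q H Ty.nat := Q.recN x Q.zero (Q.cl v0.lam.lam)

/-- Truncated subtraction. -/
def Q.monus (x y : Q H Ty.nat) : Q H Ty.nat := Q.recN y x (Q.cl (Tm.pred v1).lam.lam)

/-- Twice a number. -/
def Q.double (x : Q H Ty.nat) : Q H Ty.nat := Q.recN x Q.zero (Q.cl v1.succ.succ.lam.lam)

@[simp] theorem ev_pred (e : Env Γ₀ H) (a : Tm Γ₀ Ty.nat) : ev e a.pred = (ev e a).pred := rfl

@[simp] theorem ev_monus (e : Env Γ₀ H) (a b : Tm Γ₀ Ty.nat) :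
    ev e (a.monus b) = (ev e a).monus (ev e b) := rfl

@[simp] theorem ev_double (e : Env Γ₀ H) (a : Tm Γ₀ Ty.nat) :
    ev e a.double = (ev e a).double := rfl

@[simp] theorem Q.pred_zero : (Q.zero : Q H Ty.nat).pred = Q.zero := by simp [Q.pred]

@[simp] theorem Q.pred_succ (x : Q H Ty.nat) : x.succ.pred = x := by simp [Q.pred]

@[simp] theorem Q.monus_zero (x : Q H Ty.nat) : x.monus Q.zero = x := by simp [Q.monus]

theorem Q.monus_succ (x y : Q H Ty.nat) : x.monus y.succ = (x.monus y).pred := by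
  simp [Q.monus]

@[simp] theorem Q.double_zero : (Q.zero : Q H Ty.nat).double = Q.zero := by simp [Q.double]

@[simp] theorem Q.double_succ (x : Q H Ty.nat) : x.succ.double = x.double.succ.succ := by
  simp [Q.double]

@[simp] theorem Q.succ_monus_succ (x y : Q H Ty.nat) : x.succ.monus y.succ = x.monus y := by
  refine ev_induction (Γ₀ := [Ty.nat]) (v1.succ.monus v0.succ) (v1.monus v0) ?_ ?_
    (Env.nil.cons x) y
  · intro Γ H e
    simp [Q.monus_succ]
  · intro Γ H e n h
    simp only [ev_monus, ev_succ, ev_v0, ev_v1] at h ⊢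
    rw [Q.monus_succ, h, ← Q.monus_succ]

theorem Q.monus_eq_zero_of_succ {x y : Q H Ty.nat} (h : x.succ.monus y = Q.zero) :
    x.monus y = Q.zero := by
  rw [← Q.succ_monus_succ, Q.monus_succ, h, Q.pred_zero]

@[simp] theorem Q.monus_self (x : Q H Ty.nat) : x.monus x = Q.zero := by
  refine ev_induction (Γ₀ := []) (v0.monus v0) Tm.zero ?_ ?_ Env.nil x
  · intro Γ H e
    simp
  · intro Γ H e n h
    simpa using h

/-! ### Case distinction and bits. -/

/-- Definition by cases. -/
def condTm : Tm [] (Ty.nat ⇒ Ty.nat ⇒ Ty.nat ⇒ Ty.nat) := (Tm.natRec v2 v1 v2).lam.lam.lam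

/-- `a` if `c = 0`, and `b` otherwise. -/
def Tm.cond (c a b : Tm Γ Ty.nat) : Tm Γ Ty.nat := condTm.emb ⬝ c ⬝ a ⬝ b

/-- `a` if `c = 0`, and `b` otherwise. -/
def Q.cond (c a b : Q H Ty.nat) : Q H Ty.nat := Q.cl condTm ⬩ c ⬩ a ⬩ b

@[simp] theorem ev_cond (e : Env Γ₀ H) (c a b : Tm Γ₀ Ty.nat) :
    ev e (c.cond a b) = (ev e c).cond (ev e a) (ev e b) := by
  simp [Tm.cond, Q.cond]

@[simp] theorem Q.zero_cond (a b : Q H Ty.nat) : Q.zero.cond a b = a := by simp [Q.cond, condTm]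

@[simp] theorem Q.succ_cond (c a b : Q H Ty.nat) : c.succ.cond a b = b := by simp [Q.cond, condTm]

/-- `1` if `c = 0`, and `0` otherwise. -/
def Tm.flip (c : Tm Γ Ty.nat) : Tm Γ Ty.nat := c.cond .one .zero

/-- `1` if `c = 0`, and `0` otherwise. -/
def Q.flip (c : Q H Ty.nat) : Q H Ty.nat := c.cond Q.zero.succ Q.zero

/-- `0` if `c = 0`, and `1` otherwise. -/
def Tm.sg (c : Tm Γ Ty.nat) : Tm Γ Ty.nat := c.cond .zero .one

/-- `0` if `c = 0`, and `1` otherwise. -/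
def Q.sg (c : Q H Ty.nat) : Q H Ty.nat := c.cond Q.zero Q.zero.succ

@[simp] theorem ev_flip (e : Env Γ₀ H) (c : Tm Γ₀ Ty.nat) : ev e c.flip = (ev e c).flip := by
  simp [Tm.flip, Q.flip]

@[simp] theorem ev_sg (e : Env Γ₀ H) (c : Tm Γ₀ Ty.nat) : ev e c.sg = (ev e c).sg := by
  simp [Tm.sg, Q.sg]

@[simp] theorem Q.flip_zero : (Q.zero : Q H Ty.nat).flip = Q.zero.succ := by simp [Q.flip]

@[simp] theorem Q.flip_succ (c : Q H Ty.nat) : c.succ.flip = Q.zero := by simp [Q.flip]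

@[simp] theorem Q.sg_zero : (Q.zero : Q H Ty.nat).sg = Q.zero := by simp [Q.sg]

@[simp] theorem Q.sg_succ (c : Q H Ty.nat) : c.succ.sg = Q.zero.succ := by simp [Q.sg]

/-- Case distinction for equations. -/
theorem ev_cases {τ : Ty} (t u : Tm (Ty.nat :: Γ₀) τ)
    (h₀ : ∀ {Γ : Ctx} {H : List (Fm Γ)} (e : Env Γ₀ H),
      ev (e.cons Q.zero) t = ev (e.cons Q.zero) u)
    (h₁ : ∀ {Γ : Ctx} {H : List (Fm Γ)} (e : Env Γ₀ H) (n : Q H Ty.nat),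
      ev (e.cons n.succ) t = ev (e.cons n.succ) u)
    (e : Env Γ₀ H) (n : Q H Ty.nat) : ev (e.cons n) t = ev (e.cons n) u :=
  ev_induction t u h₀ (fun e n _ => h₁ e n) e n

@[simp] theorem Q.sg_sg (x : Q H Ty.nat) : x.sg.sg = x.sg := by
  simpa using ev_cases (Γ₀ := []) v0.sg.sg v0.sg (by simp) (by simp) Env.nil x

@[simp] theorem Q.sg_monus_one (x : Q H Ty.nat) : x.sg.monus Q.zero.succ = Q.zero := by
  simpa using ev_cases (Γ₀ := []) (v0.sg.monus .one) .zero (by simp [Q.monus_succ]) (by simp)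
    Env.nil x

theorem Q.eq_zero_of_sg {x : Q H Ty.nat} (h : x.sg = Q.zero) : x = Q.zero := by
  have key : x = x.sg.cond Q.zero x := by
    simpa using ev_cases (Γ₀ := []) v0 (v0.sg.cond .zero v0) (by simp) (by simp) Env.nil x
  rw [key, h, Q.zero_cond]

theorem Q.succ_cond_sg (x : Q H Ty.nat) :
    (x.succ.monus Q.zero.succ).cond x.succ.sg x.succ = x.succ := by
  simpa using ev_cases (Γ₀ := []) ((v0.succ.monus .one).cond v0.succ.sg v0.succ) v0.succ
    (by simp) (by simp) Env.nil x

/-- The hypothesis x ≤ 1 becomes the guard x ∸ 1 = 0 of a conditional, which leaves an unconditional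
equation to be proved by cases. -/
theorem Q.sg_eq_self {x : Q H Ty.nat} (h : x.monus Q.zero.succ = Q.zero) : x.sg = x := by
  have key : (x.monus Q.zero.succ).cond x.sg x = x := by
    simpa using ev_cases (Γ₀ := []) ((v0.monus .one).cond v0.sg v0) v0
      (by simp [Q.monus_succ]) (fun e n => by simpa using Q.succ_cond_sg n) Env.nil x
  rwa [h, Q.zero_cond] at key

theorem Q.sg_cond_zero (c x : Q H Ty.nat) :
    (c.cond x Q.zero).sg = c.cond x.sg Q.zero := by
  simpa using ev_cases (Γ₀ := [Ty.nat]) (v0.cond v1 .zero).sg (v0.cond v1.sg .zero) (by simp)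
    (by simp) (Env.nil.cons x) c

theorem Q.cond_sg_cond (c x y : Q H Ty.nat) :
    c.cond (c.cond x y).sg Q.zero = c.cond x.sg Q.zero := by
  simpa using ev_cases (Γ₀ := [Ty.nat, Ty.nat]) (v0.cond (v0.cond v1 v2).sg .zero)
    (v0.cond v1.sg .zero) (by simp) (by simp) ((Env.nil.cons y).cons x) c

theorem Q.cond_sg_flip (x : Q H Ty.nat) : x.cond x.sg x.sg.flip = Q.zero := by
  simpa using ev_cases (Γ₀ := []) (v0.cond v0.sg v0.sg.flip) .zero (by simp) (by simp) Env.nil x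

theorem Q.cond_flip_sg (x : Q H Ty.nat) : x.cond x.flip.sg x.flip.sg.flip = Q.zero.succ := by
  simpa using ev_cases (Γ₀ := []) (v0.cond v0.flip.sg v0.flip.sg.flip) .one (by simp) (by simp)
    Env.nil x

/-- If switching a bit when `c ≠ 0` does not change it, then `c = 0`. -/
theorem Q.eq_zero_of_sg_cond_flip {c x : Q H Ty.nat} (h : x.sg = (c.cond x x.flip).sg) :
    c = Q.zero := by
  -- The left side is the exclusive or of the bits of `x` and of `c.cond x x.flip`; it is 1 exactly
  -- if the bit has been switched, and `h` makes it 0.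
  have key : x.cond (c.cond x x.flip).sg (c.cond x x.flip).sg.flip = c.sg := by
    simpa using ev_cases (Γ₀ := [Ty.nat])
      (v1.cond (v0.cond v1 v1.flip).sg (v0.cond v1 v1.flip).sg.flip) v0.sg
      (fun e => by simpa using Q.cond_sg_flip _) (fun e n => by simpa using Q.cond_flip_sg _)
      (Env.nil.cons x) c
  rw [← h, Q.cond_sg_flip] at key
  exact Q.eq_zero_of_sg key.symm

/-! Pairing of a number with a bit. -/

/-- The recursion step for the parity. -/
def parityStepTm : Tm [] (Ty.nat ⇒ Ty.nat ⇒ Ty.nat) := (Tm.flip v1).lam.lam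

/-- The parity, as a closed term. -/
def parityTm : Tm [] (Ty.nat ⇒ Ty.nat) := (Tm.recN v0 .zero parityStepTm.emb).lam

/-- The parity of a number. -/
def Tm.parity (a : Tm Γ Ty.nat) : Tm Γ Ty.nat := parityTm.emb ⬝ a

/-- The parity of a number. -/
def Q.parity (x : Q H Ty.nat) : Q H Ty.nat := Q.cl parityTm ⬩ x

@[simp] theorem ev_parity (e : Env Γ₀ H) (a : Tm Γ₀ Ty.nat) :
    ev e a.parity = (ev e a).parity := by
  simp [Tm.parity, Q.parity]

@[simp] theorem Q.parity_zero : (Q.zero : Q H Ty.nat).parity = Q.zero := by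
  simp [Q.parity, parityTm, parityStepTm]

@[simp] theorem Q.parity_succ (x : Q H Ty.nat) : x.succ.parity = x.parity.flip := by
  simp [Q.parity, parityTm, parityStepTm]

/-- The recursion step for the half. -/
def halfStepTm : Tm [] (Ty.nat ⇒ Ty.nat ⇒ Ty.nat) :=
  (Tm.cond (Tm.parity v0) v1 v1.succ).lam.lam

/-- The half, as a closed term. -/
def halfTm : Tm [] (Ty.nat ⇒ Ty.nat) := (Tm.recN v0 .zero halfStepTm.emb).lam

/-- The half of a number, rounded down. -/
def Tm.half (a : Tm Γ Ty.nat) : Tm Γ Ty.nat := halfTm.emb ⬝ a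

/-- The half of a number, rounded down. -/
def Q.half (x : Q H Ty.nat) : Q H Ty.nat := Q.cl halfTm ⬩ x

@[simp] theorem ev_half (e : Env Γ₀ H) (a : Tm Γ₀ Ty.nat) : ev e a.half = (ev e a).half := by
  simp [Tm.half, Q.half]

@[simp] theorem Q.half_zero : (Q.zero : Q H Ty.nat).half = Q.zero := by
  simp [Q.half, halfTm, halfStepTm]

@[simp] theorem Q.half_succ (x : Q H Ty.nat) : x.succ.half = x.parity.cond x.half x.half.succ := by
  simp [Q.half, halfTm, halfStepTm]

@[simp] theorem Q.parity_double (x : Q H Ty.nat) : x.double.parity = Q.zero := by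
  simpa using ev_induction (Γ₀ := []) (Tm.double v0).parity .zero (by simp)
    (fun e n h => by simp at h; simp [h]) Env.nil x

@[simp] theorem Q.half_double (x : Q H Ty.nat) : x.double.half = x := by
  simpa using ev_induction (Γ₀ := []) (Tm.double v0).half v0 (by simp)
    (fun e n h => by simp at h; simp [h]) Env.nil x

/-- `2 a` if `b = 0`, and `2 a + 1` otherwise. -/
def Tm.pair (a b : Tm Γ Ty.nat) : Tm Γ Ty.nat := b.cond a.double a.double.succ

/-- `2 a` if `b = 0`, and `2 a + 1` otherwise. -/
def Q.pair (a b : Q H Ty.nat) : Q H Ty.nat := b.cond a.double a.double.succ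

@[simp] theorem ev_pair (e : Env Γ₀ H) (a b : Tm Γ₀ Ty.nat) :
    ev e (a.pair b) = (ev e a).pair (ev e b) := by
  simp [Tm.pair, Q.pair]

@[simp] theorem Q.half_pair (a b : Q H Ty.nat) : (a.pair b).half = a := by
  simpa using ev_cases (Γ₀ := [Ty.nat]) (v1.pair v0).half v1 (by simp [Q.pair])
    (by simp [Q.pair]) (Env.nil.cons a) b

@[simp] theorem Q.parity_pair (a b : Q H Ty.nat) : (a.pair b).parity = b.sg := by
  simpa using ev_cases (Γ₀ := [Ty.nat]) (v1.pair v0).parity v0.sg (by simp [Q.pair])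
    (by simp [Q.pair]) (Env.nil.cons a) b

/-! Initial segments. -/

/-- Appending a number to a coded sequence. -/
def Q.snoc (s a : Q H Ty.nat) : Q H Ty.nat :=
  Q.recN a s.double.succ (Q.cl (Tm.double v1).lam.lam)

@[simp] theorem ev_snoc (e : Env Γ₀ H) (s a : Tm Γ₀ Ty.nat) :
    ev e (s.snoc a) = (ev e s).snoc (ev e a) := rfl

theorem Tm.snoc_subst {Δ : Ctx} (s : Sub Γ Δ) (a b : Tm Γ Ty.nat) :
    (a.snoc b).subst s = (a.subst s).snoc (b.subst s) := rfl

/-- The recursion step for initial segments, as a function of the sequence. -/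
def barStepTm : Tm [] (Ty.one ⇒ Ty.nat ⇒ Ty.nat ⇒ Ty.nat) :=
  (Tm.snoc v1 (v2 ⬝ v0)).lam.lam.lam

/-- The code of an initial segment. -/
def Q.bar (f : Q H Ty.one) (n : Q H Ty.nat) : Q H Ty.nat := Q.recN n Q.zero (Q.cl barStepTm ⬩ f)

@[simp] theorem Q.bar_zero (f : Q H Ty.one) : f.bar Q.zero = Q.zero := by simp [Q.bar, barStepTm]

@[simp] theorem Q.bar_succ (f : Q H Ty.one) (n : Q H Ty.nat) :
    f.bar n.succ = (f.bar n).snoc (f ⬩ n) := by simp [Q.bar, barStepTm]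

-- `Tm.lam` produces different combinator terms from a compound `f` and from a variable in its
-- place, so this does not hold by computation: the two step functions agree only extensionally, by
-- `q_lam_congr`.
@[simp] theorem ev_bar (e : Env Γ₀ H) (f : Tm Γ₀ Ty.one) (n : Tm Γ₀ Ty.nat) :
    ev e (f.bar n) = (ev e f).bar (ev e n) := by
  obtain ⟨s, rfl⟩ := e.exists_rep
  refine congrArg (Q.recN _ _) ?_
  have he : Env.nil.cons (ev (fun _ x => q H (s x)) f) = fun _ x =>
      q H (Sub.cons (f.subst s) (fun _ (x : Var [] _) => nomatch x) x) := by
    funext τ x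
    cases x with
    | zero => exact (q_subst s f).symm
    | succ x => cases x
  rw [barStepTm, Q.cl_lam, he, ← q_subst, ← q_subst]
  refine q_lam_congr _ _ _ _ (q_lam_congr _ _ _ _ (congrArg _ ?_))
  simp only [Tm.snoc_subst, Tm.subst, Tm.wk_subst_lift]
  rfl

end

section

variable {Γ Γ₀ : Ctx} {H : List (Fm Γ)}

/-! Codes of binary sequences. -/

/-- `λ f k, f (k + 1)`. -/
def shiftTm : Tm [] (Ty.one ⇒ Ty.one) := (v1 ⬝ v0.succ).lam.lam

/-- The recursion step for codes. -/
def codeStepTm : Tm [] ((Ty.one ⇒ Ty.nat) ⇒ Ty.nat ⇒ Ty.one ⇒ Ty.nat) :=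
  (Tm.pair (v2 ⬝ (shiftTm.emb ⬝ v0)) (v0 ⬝ .zero)).lam.lam.lam

/-- The number with the binary digits `f 0, …, f (n - 1)`, as a function of `n` and `f`. -/
def codeTm : Tm [] (Ty.nat ⇒ Ty.one ⇒ Ty.nat) :=
  (Tm.recN v0 (.con (.K _ _) ⬝ .zero) codeStepTm.emb).lam

/-- The recursion step for digits. -/
def digitStepTm : Tm [] ((Ty.nat ⇒ Ty.nat) ⇒ Ty.nat ⇒ Ty.nat ⇒ Ty.nat) :=
  (v2 ⬝ Tm.half v0).lam.lam.lam

/-- The binary digit with index `k` of the number `j`, as a function of `k` and `j`. -/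
def digitTm : Tm [] (Ty.nat ⇒ Ty.nat ⇒ Ty.nat) := (Tm.recN v0 parityTm.emb digitStepTm.emb).lam

namespace Q

@[simp] theorem shift_app (f : Q H Ty.one) (k : Q H Ty.nat) : cl shiftTm ⬩ f ⬩ k = f ⬩ k.succ := by
  simp [shiftTm]

@[simp] theorem code_zero (f : Q H Ty.one) : cl codeTm ⬩ zero ⬩ f = zero := by
  simp [codeTm]

@[simp] theorem code_succ (n : Q H Ty.nat) (f : Q H Ty.one) :
    cl codeTm ⬩ n.succ ⬩ f = pair (cl codeTm ⬩ n ⬩ (cl shiftTm ⬩ f)) (f ⬩ zero) := by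
  simp [codeTm, codeStepTm]

@[simp] theorem digit_zero (j : Q H Ty.nat) : cl digitTm ⬩ zero ⬩ j = j.parity := by
  simp [digitTm, Q.parity]

@[simp] theorem digit_succ (k j : Q H Ty.nat) :
    cl digitTm ⬩ k.succ ⬩ j = cl digitTm ⬩ k ⬩ j.half := by
  simp [digitTm, digitStepTm]

theorem half_code (n : Q H Ty.nat) (f : Q H Ty.one) :
    (cl codeTm ⬩ n ⬩ f).half = cl codeTm ⬩ n.pred ⬩ (cl shiftTm ⬩ f) := by
  simpa using ev_cases (Γ₀ := [Ty.one]) (Tm.half (codeTm.emb ⬝ v0 ⬝ v1))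
    (codeTm.emb ⬝ Tm.pred v0 ⬝ (shiftTm.emb ⬝ v1)) (by simp) (by simp) (Env.nil.cons f) n

/-- The conditions k + 2 ≤ n and k + 1 ≤ n - 1 are equivalent even for n = 0, where the predecessor
is 0 and both fail. -/
theorem succ_monus_cond (k n a : Q H Ty.nat) :
    (k.succ.succ.monus n).cond a zero = (k.succ.monus n.pred).cond a zero := by
  simpa using ev_cases (Γ₀ := [Ty.nat, Ty.nat]) (Tm.cond (Tm.monus v1.succ.succ v0) v2 .zero)
    (Tm.cond (Tm.monus v1.succ (Tm.pred v0)) v2 .zero) (by simp) (by simp)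
    ((Env.nil.cons a).cons k) n

theorem cond_parity_code (n : Q H Ty.nat) (f : Q H Ty.one) :
    (zero.succ.monus n).cond (cl codeTm ⬩ n ⬩ f).parity zero =
      (zero.succ.monus n).cond (f ⬩ zero).sg zero := by
  simpa using ev_cases (Γ₀ := [Ty.one])
    (Tm.cond (Tm.monus .one v0) (Tm.parity (codeTm.emb ⬝ v0 ⬝ v1)) .zero)
    (Tm.cond (Tm.monus .one v0) (Tm.sg (v1 ⬝ .zero)) .zero) (by simp) (by simp)
    (Env.nil.cons f) n

/-- The digit with index `k < n` of the code of `f 0, …, f (n - 1)` is `f k`. -/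
theorem cond_digit_code (k n : Q H Ty.nat) (f : Q H Ty.one) :
    (k.succ.monus n).cond (cl digitTm ⬩ k ⬩ (cl codeTm ⬩ n ⬩ f)) zero =
      (k.succ.monus n).cond (f ⬩ k).sg zero := by
  -- The induction on `k` must be uniform in `n` and `f`. As only equations are available, both
  -- sides are abstracted to closed terms, and the induction proves an equation of functions of `n`
  -- and `f`.
  obtain ⟨t, ht⟩ : ∃ t : Tm [] (Ty.nat ⇒ Ty.nat ⇒ Ty.one ⇒ Ty.nat),
      ∀ {Γ : Ctx} {H : List (Fm Γ)} (k n : Q H Ty.nat) (f : Q H Ty.one), cl t ⬩ k ⬩ n ⬩ f =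
        (k.succ.monus n).cond (cl digitTm ⬩ k ⬩ (cl codeTm ⬩ n ⬩ f)) zero :=
    ⟨(Tm.cond (Tm.monus v2.succ v1)
      (digitTm.emb ⬝ v2 ⬝ (codeTm.emb ⬝ v1 ⬝ v0)) .zero).lam.lam.lam, by simp⟩
  obtain ⟨u, hu⟩ : ∃ u : Tm [] (Ty.nat ⇒ Ty.nat ⇒ Ty.one ⇒ Ty.nat),
      ∀ {Γ : Ctx} {H : List (Fm Γ)} (k n : Q H Ty.nat) (f : Q H Ty.one), cl u ⬩ k ⬩ n ⬩ f =
        (k.succ.monus n).cond (f ⬩ k).sg zero :=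
    ⟨(Tm.cond (Tm.monus v2.succ v1) (Tm.sg (v0 ⬝ v2)) .zero).lam.lam.lam, by simp⟩
  rw [← ht, ← hu]
  refine congrArg (fun g => g ⬩ n ⬩ f) ?_
  suffices h : ev (Env.nil.cons k) (t.emb ⬝ v0) = ev (Env.nil.cons k) (u.emb ⬝ v0) by simpa using h
  refine ev_induction (t.emb ⬝ v0) (u.emb ⬝ v0) (fun e => ?_) (fun e k h => ?_) Env.nil k
  · suffices h : ev e (t.emb ⬝ .zero) = ev e (u.emb ⬝ .zero) by simpa using h
    refine ev_ext _ _ (fun e n => ?_) e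
    suffices h : ev (e.cons n) (t.emb ⬝ .zero ⬝ v0) = ev (e.cons n) (u.emb ⬝ .zero ⬝ v0) by
      simpa using h
    refine ev_ext _ _ (fun e f => ?_) _
    simp only [ev_app, ev_emb, ev_zero, ht, hu, digit_zero, cond_parity_code]
  · suffices h' : ev (e.cons k) (t.emb ⬝ v0.succ) = ev (e.cons k) (u.emb ⬝ v0.succ) by
      simpa using h'
    refine ev_ext_of_eq (t.emb ⬝ v0) (u.emb ⬝ v0) _ _ (fun e n h => ?_) (e.cons k) h
    suffices h' : ev (e.cons n) (t.emb ⬝ v1.succ ⬝ v0) = ev (e.cons n) (u.emb ⬝ v1.succ ⬝ v0) by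
      simpa using h'
    refine ev_ext_of_eq (t.emb ⬝ v1) (u.emb ⬝ v1) _ _ (fun e f h => ?_) (e.cons n) (by simpa using h)
    simp only [ev_app, ev_emb, ev_succ, ht, hu] at h ⊢
    -- Removing the lowest digit shortens the sequence and shifts it, so the induction hypothesis is
    -- used at `n.pred` and the shifted `f`.
    have h' := congrArg (fun g => g ⬩ (ev e v0).pred ⬩ (cl shiftTm ⬩ f)) h
    simp only [ht, hu, shift_app] at h'
    rw [digit_succ, half_code, succ_monus_cond, h', succ_monus_cond]

end Q

/-! Agreement of sequences. -/

/-- `f` below `n`, and zero from `n` on, as a function of `n` and `f`. -/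
def truncTm : Tm [] (Ty.nat ⇒ Ty.one ⇒ Ty.one) :=
  (Tm.cond (Tm.monus v0.succ v2) (v1 ⬝ v0) .zero).lam.lam.lam

/-- `λ f k, sg (f k)`. -/
def sgFunTm : Tm [] (Ty.one ⇒ Ty.one) := (Tm.sg (v1 ⬝ v0)).lam.lam

/-- `f` below `n`, and the flipped values of `f` from `n` on, as a function of `n` and `f`. -/
def flipFromTm : Tm [] (Ty.nat ⇒ Ty.one ⇒ Ty.one) :=
  (Tm.cond (Tm.monus v0.succ v2) (v1 ⬝ v0) (Tm.flip (v1 ⬝ v0))).lam.lam.lam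

/-- The sequence of the digits of a number. -/
def digitsTm : Tm [] (Ty.nat ⇒ Ty.one) := (digitTm.emb ⬝ v0 ⬝ v1).lam.lam

namespace Q

@[simp] theorem trunc_app (n : Q H Ty.nat) (f : Q H Ty.one) (k : Q H Ty.nat) :
    cl truncTm ⬩ n ⬩ f ⬩ k = (k.succ.monus n).cond (f ⬩ k) zero := by
  simp [truncTm]

@[simp] theorem sgFun_app (f : Q H Ty.one) (k : Q H Ty.nat) :
    cl sgFunTm ⬩ f ⬩ k = (f ⬩ k).sg := by
  simp [sgFunTm]

@[simp] theorem flipFrom_app (n : Q H Ty.nat) (f : Q H Ty.one) (k : Q H Ty.nat) :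
    cl flipFromTm ⬩ n ⬩ f ⬩ k = (k.succ.monus n).cond (f ⬩ k) (f ⬩ k).flip := by
  simp [flipFromTm]

@[simp] theorem digits_app (j k : Q H Ty.nat) :
    cl digitsTm ⬩ j ⬩ k = cl digitTm ⬩ k ⬩ j := by
  simp [digitsTm]

theorem trunc_flipFrom (n : Q H Ty.nat) (f : Q H Ty.one) :
    cl truncTm ⬩ n ⬩ (cl sgFunTm ⬩ (cl flipFromTm ⬩ n ⬩ f)) =
      cl truncTm ⬩ n ⬩ (cl sgFunTm ⬩ f) := by
  simpa using ev_ext (Γ₀ := [Ty.nat, Ty.one])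
    (truncTm.emb ⬝ v0 ⬝ (sgFunTm.emb ⬝ (flipFromTm.emb ⬝ v0 ⬝ v1)))
    (truncTm.emb ⬝ v0 ⬝ (sgFunTm.emb ⬝ v1)) (by simp [cond_sg_cond])
    ((Env.nil.cons f).cons n)

theorem trunc_digits_code (n : Q H Ty.nat) (f : Q H Ty.one) :
    cl truncTm ⬩ n ⬩ (cl sgFunTm ⬩ (cl digitsTm ⬩ (cl codeTm ⬩ n ⬩ f))) =
      cl truncTm ⬩ n ⬩ (cl sgFunTm ⬩ f) := by
  simpa using ev_ext (Γ₀ := [Ty.nat, Ty.one])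
    (truncTm.emb ⬝ v0 ⬝ (sgFunTm.emb ⬝ (digitsTm.emb ⬝ (codeTm.emb ⬝ v0 ⬝ v1))))
    (truncTm.emb ⬝ v0 ⬝ (sgFunTm.emb ⬝ v1)) (fun e k => by
      simp [← sg_cond_zero, cond_digit_code])
    ((Env.nil.cons f).cons n)

/-- For c = i + 1 ∸ n the inner guard `c.pred` is i ∸ n, the guard of the induction hypothesis in
`cond_bar_trunc`. -/
theorem cond_snoc (c a x : Q H Ty.nat) :
    c.cond (a.snoc x) zero = c.cond ((c.pred.cond a zero).snoc (c.cond x zero)) zero := by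
  simpa using ev_cases (Γ₀ := [Ty.nat, Ty.nat]) (v0.cond (v1.snoc v2) .zero)
    (v0.cond (((Tm.pred v0).cond v1 .zero).snoc (v0.cond v2 .zero)) .zero) (by simp) (by simp)
    ((Env.nil.cons x).cons a) c

theorem cond_bar_trunc (n : Q H Ty.nat) (f : Q H Ty.one) (i : Q H Ty.nat) :
    (i.monus n).cond (f.bar i) zero = (i.monus n).cond ((cl truncTm ⬩ n ⬩ f).bar i) zero := by
  have key := ev_induction (Γ₀ := [Ty.nat, Ty.one])
    (Tm.cond (Tm.monus v0 v1) (Tm.bar v2 v0) .zero)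
    (Tm.cond (Tm.monus v0 v1) (Tm.bar (truncTm.emb ⬝ v1 ⬝ v2) v0) .zero) (fun e => by simp)
    (fun e i h => ?_) ((Env.nil.cons f).cons n) i
  · simpa using key
  · simp only [ev_cond, ev_monus, ev_bar, ev_app, ev_emb, ev_v0, ev_v1, ev_v2, ev_zero,
      bar_succ, trunc_app] at h ⊢
    have hi : (i.succ.monus (ev e v0)).pred = i.monus (ev e v0) := by
      rw [← monus_succ, succ_monus_succ]
    rw [cond_snoc, cond_snoc _ (bar _ _), hi, h]
    congr 2
    simpa using (ev_cases (Γ₀ := [Ty.nat]) (v0.cond v1 .zero) (v0.cond (v0.cond v1 .zero) .zero)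
      (by simp) (by simp) (Env.nil.cons (ev e v1 ⬩ i)) (i.succ.monus (ev e v0)))

/-- Sequences that agree below `n` have the same initial segments of length at most `n`. -/
theorem bar_eq_of_trunc_eq {n i : Q H Ty.nat} {f g : Q H Ty.one}
    (h : cl truncTm ⬩ n ⬩ f = cl truncTm ⬩ n ⬩ g) (hi : i.monus n = zero) : f.bar i = g.bar i := by
  have hf := cond_bar_trunc n f i
  rwa [h, ← cond_bar_trunc, hi, zero_cond, zero_cond] at hf

end Q

end

section

variable {Γ Γ₀ Δ : Ctx} {H : List (Fm Γ)} {ρ τ : Ty}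

/-! Formulas in the term model. -/

theorem Proves.conj_intro {φ ψ : Fm Γ} (hφ : Proves H φ) (hψ : Proves H ψ) :
    Proves H (φ.conj ψ) := by
  refine .imp_intro (.imp_elim (.imp_elim (φ := φ) (.hyp (List.mem_cons_self)) ?_) ?_)
  · exact hφ.weaken (List.subset_cons_self _ _)
  · exact hψ.weaken (List.subset_cons_self _ _)

/-- A negated equation is not an identity of the model, so rewriting below the negation is carried
out on derivations. -/
theorem Proves.neg_eq_congr {a b a' b' : Tm Γ Ty.nat} (h : Proves H (Fm.eq a b).neg)
    (ha : q H a = q H a') (hb : q H b = q H b') : Proves H (Fm.eq a' b').neg := by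
  refine .imp_intro (.imp_elim (h.weaken (List.subset_cons_self _ _)) ?_)
  have ha' := (q_eq.1 ha).weaken (List.subset_cons_self (Fm.eq a' b') _)
  have hb' := (q_eq.1 hb).weaken (List.subset_cons_self (Fm.eq a' b') _)
  exact ha'.eqAt_trans (.eqAt_trans (τ := Ty.nat) (.hyp List.mem_cons_self) hb'.eqAt_symm)

theorem Tm.emb_subst (c : Tm [] τ) (s : Sub Γ Δ) : (c.emb).subst s = c.emb := by
  rw [Tm.emb, Tm.subst_subst, Tm.emb]
  congr 1
  funext τ x
  cases x

theorem q_app (f : Tm Γ (ρ ⇒ τ)) (a : Tm Γ ρ) : q H (f ⬝ a) = q H f ⬩ q H a := rfl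

theorem q_emb (c : Tm [] τ) : q H c.emb = Q.cl c := by rw [q_eq_ev, ev_emb]

theorem proves_le {a b : Tm Γ Ty.nat} :
    Proves H (.le a b) ↔ (q H a).monus (q H b) = Q.zero :=
  (q_eq (τ := Ty.nat)).symm

theorem proves_eq_subst {s : Sub Γ₀ Γ} {a b : Tm Γ₀ Ty.nat} :
    Proves H ((Fm.eq a b).subst s) ↔
      ev (fun _ x => q H (s x)) a = ev (fun _ x => q H (s x)) b := by
  rw [← q_subst, ← q_subst]
  exact (q_eq (τ := Ty.nat)).symm

theorem Fm.binary_subst (s : Sub Γ Δ) (f : Tm Γ Ty.one) :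
    (Fm.binary f).subst s = Fm.binary (f.subst s) := by
  rw [Fm.binary, Fm.binary, ← Tm.wk_subst_lift]
  rfl

theorem sgFun_eq_self {f : Tm Γ Ty.one} (h : Proves H (.binary f)) :
    Q.cl sgFunTm ⬩ q H f = q H f := by
  rw [← q_emb, ← q_app, q_eq]
  refine .cut (.all_intro (q_eq.1 ?_)) h
  set H' := (Fm.binary f :: H).map (Fm.wk (ρ := Ty.nat))
  have hyp : Proves H' (Fm.binary f.wk) :=
    .hyp (List.mem_cons.2 (.inl (Fm.binary_subst _ f).symm))
  have h₀ := Proves.all_elim v0 hyp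
  have h₁ : Proves H' (.le (f.wk ⬝ v0) .one) := by
    have : (Fm.le ((f.wk (ρ := Ty.nat)).wk ⬝ v0) .one).inst v0 = Fm.le (f.wk ⬝ v0) .one := by
      conv_rhs => rw [← Tm.wk_subst_single v0 (f.wk (ρ := Ty.nat))]
      rfl
    rwa [this] at h₀
  have h₂ := Q.sg_eq_self (proves_le.1 h₁)
  rw [Tm.wk, Tm.subst, Tm.emb_subst, q_app, q_app, q_emb, Q.sgFun_app]
  exact h₂

/-- Applying `sg` pointwise makes any sequence provably binary, so that neither the flipped
sequences nor the digit sequences need an argument of their own. -/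
theorem binary_sgFun (f : Tm Γ Ty.one) : Proves H (.binary (sgFunTm.emb ⬝ f)) := by
  refine .all_intro (proves_le.2 ?_)
  rw [Tm.wk, Tm.subst, Tm.emb_subst, q_app, q_app, q_emb, Q.sgFun_app]
  exact Q.sg_monus_one _

/-- The value of a functional with a modulus `MUC(Ω)` depends on an initial segment only. -/
theorem app_eq_of_bar_eq {s : Sub [Ty.three] Γ} (h : Proves H ((MUC v0).subst s))
    {Y : Tm Γ Ty.two} {f g : Tm Γ Ty.one} (hf : Proves H (.binary f)) (hg : Proves H (.binary g))
    (hfg : (q H f).bar (q H (s .zero) ⬩ q H Y) = (q H g).bar (q H (s .zero) ⬩ q H Y)) :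
    q H Y ⬩ q H f = q H Y ⬩ q H g := by
  have h₁ := ((h.all_subst_elim Y).all_subst_elim f).all_subst_elim g
  have h₂ := Proves.imp_elim h₁ (by rwa [Fm.binary_subst])
  have h₃ := Proves.imp_elim h₂ (by rwa [Fm.binary_subst])
  have h₄ := Proves.imp_elim h₃ (proves_eq_subst.2 (by
    simp only [← Env.cons_q, ev_bar, ev_app, ev_wk, ev_v0, ev_v1, ev_v2]
    exact hfg))
  simpa only [proves_eq_subst, ← Env.cons_q, ev_app, ev_v0, ev_v1, ev_v2] using h₄

/-! ### The bound on Cantor space and the special fan functional. -/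

/-- `λ Y f, 2 (Y f) + f (Y f)`. -/
def graphTm : Tm [] (Ty.two ⇒ Ty.two) := (Tm.pair (v1 ⬝ v0) (v0 ⬝ (v1 ⬝ v0))).lam.lam

/-- A bound for the values of `Y` at binary sequences, as a function of `Ω` and `Y`. -/
def boundTm : Tm [] (Ty.three ⇒ Ty.two ⇒ Ty.nat) := (v1 ⬝ (graphTm.emb ⬝ v0)).lam.lam

theorem Q.graph_app (Y : Q H Ty.two) (f : Q H Ty.one) :
    Q.cl graphTm ⬩ Y ⬩ f = Q.pair (Y ⬩ f) (f ⬩ (Y ⬩ f)) := by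
  simp [graphTm]

@[simp] theorem Q.bound_app (Om : Q H Ty.three) (Y : Q H Ty.two) :
    Q.cl boundTm ⬩ Om ⬩ Y = Om ⬩ (Q.cl graphTm ⬩ Y) := by
  simp [boundTm]

/-- Binary sequences are mapped below the modulus of `graphTm`. -/
theorem app_lt_bound {s : Sub [Ty.three] Γ} (h : Proves H ((MUC v0).subst s))
    (Y : Tm Γ Ty.two) {f : Tm Γ Ty.one} (hf : Proves H (.binary f)) :
    (q H Y ⬩ q H f).succ.monus (q H (s .zero) ⬩ (Q.cl graphTm ⬩ q H Y)) = Q.zero := by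
  -- The comparison sequence agrees with `f` below the modulus and differs from it everywhere above.
  have key := app_eq_of_bar_eq h (Y := graphTm.emb ⬝ Y) hf
    (binary_sgFun (flipFromTm.emb ⬝ (s .zero ⬝ (graphTm.emb ⬝ Y)) ⬝ f)) (by
      simp only [q_app, q_emb]
      refine Q.bar_eq_of_trunc_eq ?_ (Q.monus_self _)
      rw [Q.trunc_flipFrom, sgFun_eq_self hf])
  simp only [q_app, q_emb, Q.graph_app] at key
  -- The half of the coded value shows that `Y` takes the same value at both sequences; the parity
  -- shows that their bits at this place agree, so the place lies below the modulus.
  have hh := congrArg Q.half key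
  have hp := congrArg Q.parity key
  simp only [Q.half_pair, Q.parity_pair] at hh hp
  rw [← hh, Q.sgFun_app, Q.flipFrom_app, Q.sg_sg] at hp
  exact Q.eq_zero_of_sg_cond_flip hp

/-- The special fan functional of `Ω`: the list of all binary sequences whose length is a bound for
the values of `g`. -/
def fanTransformer : FanTransformer where
  num := boundTm
  -- The inner bound is n; the outer one bounds the functional that sends a sequence to the number
  -- with its first n digits, and so exceeds every index that is needed.
  len := (boundTm.emb ⬝ v1 ⬝ (codeTm.emb ⬝ (boundTm.emb ⬝ v1 ⬝ v0))).lam.lam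
  entry := (sgFunTm.emb ⬝ (digitsTm.emb ⬝ v0)).lam.lam.lam

theorem Q.len_app (Om : Q H Ty.three) (g : Q H Ty.two) :
    Q.cl fanTransformer.len ⬩ Om ⬩ g =
      Om ⬩ (Q.cl graphTm ⬩ (Q.cl codeTm ⬩ (Om ⬩ (Q.cl graphTm ⬩ g)))) := by
  simp [fanTransformer]

theorem Q.entry_app (Om : Q H Ty.three) (g : Q H Ty.two) (j : Q H Ty.nat) :
    Q.cl fanTransformer.entry ⬩ Om ⬩ g ⬩ j = Q.cl sgFunTm ⬩ (Q.cl digitsTm ⬩ j) := by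
  simp [fanTransformer]

theorem Q.num_app (Om : Q H Ty.three) (g : Q H Ty.two) :
    Q.cl fanTransformer.num ⬩ Om ⬩ g = Om ⬩ (Q.cl graphTm ⬩ g) := Q.bound_app Om g

theorem epa_MUC_imp_SCF :
    EPA (.all Ty.three (.imp (MUC v0) (SCF fanTransformer.apply))) := by
  refine .all_intro (.imp_intro (.all_intro (.all_intro (.imp_intro (.imp_intro
    (.all_intro (.imp_intro (.imp_intro ?_))))))))
  -- The variables `v3`, `v2`, `v1`, `v0` are now Ω, g, T and β. The existential quantifier
  -- abbreviates ¬∀¬, so the last hypothesis denies that a witness exists.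
  generalize hH : (List.cons _ _ : List (Fm [Ty.one, Ty.one, Ty.two, Ty.three])) = H
  have hMUC : Proves H ((MUC v0).subst fun _ x => .var x.succ.succ.succ) := by
    subst hH
    refine .hyp ?_
    simp [Fm.wk, Fm.subst_subst, Tm.subst]
  have hβ : Proves H (.binary v0) := by
    subst hH
    exact .hyp (by simp)
  have hent : Proves H (Fm.wk (.all Ty.nat
      (Fm.lt v0 (fanTransformer.apply.wk.wk.wk.len ⬝ v2) ⟹
      (Fm.mem (Tm.bar (fanTransformer.apply.wk.wk.wk.entry ⬝ v2 ⬝ v0)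
        (v2 ⬝ (fanTransformer.apply.wk.wk.wk.entry ⬝ v2 ⬝ v0))) v1).neg))) := by
    subst hH
    exact .hyp (by simp)
  have hex : Proves H (.all Ty.nat
      ((Fm.le v0 (fanTransformer.apply.wk.wk.wk.wk.num ⬝ v3)).conj
        (Fm.mem (Tm.bar v1 v0) v2).neg).neg) := by
    subst hH
    exact .hyp List.mem_cons_self
  have he : (fun _ x => q H (.var x) : Env [Ty.one, Ty.one, Ty.two, Ty.three] H) =
      (((Env.nil.cons (q H v3)).cons (q H v2)).cons (q H v1)).cons (q H v0) := by
    funext τ x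
    rcases x with _ | _ | _ | _ | x <;> first | rfl | cases x
  have he' : (fun _ x => q H (.var x.succ) : Env [Ty.one, Ty.two, Ty.three] H) =
      ((Env.nil.cons (q H v3)).cons (q H v2)).cons (q H v1) := by
    funext τ x
    rcases x with _ | _ | _ | x <;> first | rfl | cases x
  have hsingle : ∀ {ρ : Ty} (t : Tm [Ty.one, Ty.one, Ty.two, Ty.three] ρ),
      (fun _ x => q H (Sub.single t x)) = Env.cons (fun _ x => q H (.var x)) (q H t) := by
    intro ρ t
    funext τ x
    cases x <;> rfl
  -- `j` is the number whose binary digits are the first n values of β, and `α` is the list entry at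
  -- this index.
  let j : Tm [Ty.one, Ty.one, Ty.two, Ty.three] Ty.nat :=
    codeTm.emb ⬝ (boundTm.emb ⬝ v3 ⬝ v2) ⬝ v0
  let α : Tm [Ty.one, Ty.one, Ty.two, Ty.three] Ty.one := sgFunTm.emb ⬝ (digitsTm.emb ⬝ j)
  have hj : (q H j).succ.monus (q H v3 ⬩ (Q.cl graphTm ⬩ (Q.cl codeTm ⬩
      (q H v3 ⬩ (Q.cl graphTm ⬩ q H v2))))) = Q.zero := by
    have h := app_lt_bound hMUC (codeTm.emb ⬝ (boundTm.emb ⬝ v3 ⬝ v2)) hβ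
    simp only [q_app, q_emb, Q.bound_app] at h
    simp only [j, q_app, q_emb, Q.bound_app]
    exact h
  have hα : (q H v2 ⬩ q H α).monus (q H v3 ⬩ (Q.cl graphTm ⬩ q H v2)) = Q.zero :=
    Q.monus_eq_zero_of_succ (app_lt_bound hMUC v2 (binary_sgFun _))
  have hbar : (q H α).bar (q H v2 ⬩ q H α) = (q H v0).bar (q H v2 ⬩ q H α) := by
    refine Q.bar_eq_of_trunc_eq ?_ hα
    conv_rhs => rw [← sgFun_eq_self hβ]
    simp only [α, j, q_app, q_emb, Q.bound_app, Q.trunc_digits_code]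
  have hq : q H α = Q.cl sgFunTm ⬩ (Q.cl digitsTm ⬩ q H j) := by simp only [α, q_app, q_emb]
  have h₁ := Proves.imp_elim (hent.all_subst_elim j) (proves_eq_subst.2 (by
    simp only [← Env.cons_q, he', ev_monus, ev_succ, ev_v0, ev_app, ev_v1, ev_v2, FanTm.wk,
      FanTransformer.apply, ev_wk, ev_closed, Q.len_app, ev_zero]
    exact hj))
  -- The witness is i = g(α): it is within the bound, and the initial segments of α and β of this
  -- length coincide.
  have h₂ := hex.all_elim (v2 ⬝ α)
  refine .imp_elim h₂ (.conj_intro (proves_eq_subst.2 ?_) (h₁.neg_eq_congr ?_ ?_))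
  · simp only [hsingle, he, ev_monus, ev_v0, ev_app, ev_v1, ev_v2, ev_v3, FanTm.wk,
      FanTransformer.apply, ev_wk, ev_closed, Q.num_app, ev_zero]
    exact hα
  · simp only [q_subst, ← Env.cons_q, hsingle, he, he', ev_v0, ev_app, ev_v1, ev_v2, FanTm.wk,
      FanTransformer.apply, ev_wk, ev_closed, Q.entry_app, ev_bar]
    rw [← hq, q_app v2 α, hbar]
  · simp only [q_subst, ev_one]

end

end EPAomega

theorem theorem4p2 :
    ∃ t : EPAomega.FanTransformer,
      EPAomega.EPA (.all EPAomega.Ty.three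
        (.imp (EPAomega.MUC EPAomega.v0) (EPAomega.SCF t.apply))) :=
  ⟨EPAomega.fanTransformer, EPAomega.epa_MUC_imp_SCF⟩
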